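/- Let $k$ be an algebraically closed field of characteristic $p>0$ and let $D=\operatorname{Spec}A$ be a connected finite $k$-scheme, i.e. $A=\mathcal O(D)$ is a finite-dimensional local $k$-algebra; let $\mathfrak m$ be its maximal ideal and $s:\operatorname{Spec}k\to D$ its unique point. Let $\mathcal S_D$ be the $k$-linear tensor category whose objects are pairs $(V,\beta)$ with $V$ a finite-dimensional $k$-vector space and $\beta$ an $A$-linear automorphism of $V\otimes_kA$ with $s^*(\beta)=\mathrm{id}_V$, whose arrows $(V,\beta)\to(V',\beta')$ are the $k$-linear maps $f:V\to V'$ with $\beta'\circ(f\otimes\mathrm{id}_A)=(f\otimes\mathrm{id}_A)\circ\beta$, and whose tensor product is $(V,\beta)\otimes(V',\beta')=(V\otimes_kV',\beta\otimes_A\beta')$, with unit object $(k,\mathrm{id})$. Let $\sigma_D:\mathcal S_D\to\mathrm{vect}_k$ be the forgetful functor, and let $\Sigma_D=\underline{\mathrm{Aut}}^{\otimes}(\sigma_D)$ be the group scheme associated to $(\mathcal S_D,\sigma_D)$ by Tannakian duality: for a commutative $k$-algebra $R$, $\Sigma_D(R)$ is the group of tensor automorphisms of the functor $(V,\beta)\mapsto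 V\otimes_kR$. Then $\Sigma_D$ is a local group scheme, i.e. it is (represented by) an affine group scheme over $k$ having exactly one closed point. Moreover, for an ideal $\mathfrak a\subset A$ let $\mathfrak a^{[p^i]}$ be the ideal generated by $\{a^{p^i}:a\in\mathfrak a\}$, and let $h\ge1$ be such that $\mathfrak m^{[p^h]}=0$ while $\mathfrak m^{[p^{h-1}]}\ne0$. Then $\Sigma_D$ is annihilated by $\mathrm{Fr}^h$ but not by $\mathrm{Fr}^{h-1}$; that is, the iterated Frobenius morphism $\mathrm{Fr}^n:\Sigma_D\to\Sigma_D^{(p^n)}$ is trivial for $n=h$ and not for $n=h-1$, and $\Sigma_D$ has height exactly $h$ (the least $n$ for which $\mathrm{Fr}^n$ is trivial). -/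

import Mathlib

open CategoryTheory
open scoped TensorProduct

universe u w

namespace SigmaD

section BaseChange

variable {k : Type u} [CommRing k] {R S T : Type u} [CommRing R] [CommRing S] [CommRing T]
  [Algebra k R] [Algebra k S] [Algebra k T]
  {V W : Type u} [AddCommGroup V] [Module k V] [AddCommGroup W] [Module k W]

/-- The base change along `φ : R → S` of an endomorphism `f` of the `R`-module `R ⊗ V`,
as an endomorphism of `S ⊗ V`: it sends `s ⊗ v` to `s • (φ ⊗ id) (f (1 ⊗ v))`. -/
noncomputable def pullHom (φ : R →ₐ[k] S) (f : R ⊗[k] V →ₗ[R] R ⊗[k] V) :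
    S ⊗[k] V →ₗ[S] S ⊗[k] V :=
  LinearMap.liftBaseChange S
    ((φ.toLinearMap.rTensor V) ∘ₗ (f.restrictScalars k) ∘ₗ (TensorProduct.mk k R V 1))

theorem pullHom_tmul (φ : R →ₐ[k] S) (f : R ⊗[k] V →ₗ[R] R ⊗[k] V) (s : S) (v : V) :
    pullHom φ f (s ⊗ₜ v) = s • φ.toLinearMap.rTensor V (f (1 ⊗ₜ v)) := rfl

theorem rTensor_smul (φ : R →ₐ[k] S) (r : R) (x : R ⊗[k] V) :
    φ.toLinearMap.rTensor V (r • x) = φ r • φ.toLinearMap.rTensor V x := by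
  induction x with
  | zero => simp
  | tmul a v => simp [TensorProduct.smul_tmul']
  | add x y hx hy => simp only [smul_add, map_add, hx, hy]

/-- The defining property of the base change: compatibility with `φ ⊗ id : R ⊗ V → S ⊗ V`. -/
theorem pullHom_rTensor (φ : R →ₐ[k] S) (f : R ⊗[k] V →ₗ[R] R ⊗[k] V) (x : R ⊗[k] V) :
    pullHom φ f (φ.toLinearMap.rTensor V x) = φ.toLinearMap.rTensor V (f x) := by
  induction x with
  | zero => simp
  | tmul a v =>
    have h : (a ⊗ₜ[k] v : R ⊗[k] V) = a • ((1 : R) ⊗ₜ[k] v) := by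
      simp [TensorProduct.smul_tmul']
    rw [h, rTensor_smul, LinearMap.map_smul, LinearMap.map_smul, rTensor_smul]
    simp [pullHom_tmul]
  | add x y hx hy => simp only [map_add, hx, hy]

theorem pullHom_comp (φ : R →ₐ[k] S) (f g : R ⊗[k] V →ₗ[R] R ⊗[k] V) :
    pullHom φ (f ∘ₗ g) = pullHom φ f ∘ₗ pullHom φ g := by
  ext v
  simp [pullHom_tmul, pullHom_rTensor]

theorem pullHom_id (φ : R →ₐ[k] S) :
    pullHom φ (LinearMap.id : R ⊗[k] V →ₗ[R] R ⊗[k] V) = LinearMap.id := by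
  ext v
  simp [pullHom_tmul]

/-- The base change of an automorphism of `R ⊗ V` along `φ : R → S`. -/
noncomputable def pull (φ : R →ₐ[k] S) (f : (R ⊗[k] V) ≃ₗ[R] (R ⊗[k] V)) :
    (S ⊗[k] V) ≃ₗ[S] (S ⊗[k] V) :=
  LinearEquiv.ofLinearMap (pullHom φ f) (pullHom φ f.symm)
    (by rw [← pullHom_comp]; simp [pullHom_id])
    (by rw [← pullHom_comp]; simp [pullHom_id])

theorem pull_tmul (φ : R →ₐ[k] S) (f : (R ⊗[k] V) ≃ₗ[R] (R ⊗[k] V)) (s : S) (v : V) :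
    pull φ f (s ⊗ₜ v) = s • φ.toLinearMap.rTensor V (f (1 ⊗ₜ v)) := rfl

theorem pull_rTensor (φ : R →ₐ[k] S) (f : (R ⊗[k] V) ≃ₗ[R] (R ⊗[k] V)) (x : R ⊗[k] V) :
    pull φ f (φ.toLinearMap.rTensor V x) = φ.toLinearMap.rTensor V (f x) :=
  pullHom_rTensor φ f.toLinearMap x

theorem pull_ext {f g : (R ⊗[k] V) ≃ₗ[R] (R ⊗[k] V)}
    (h : ∀ v : V, f (1 ⊗ₜ v) = g (1 ⊗ₜ v)) : f = g := by
  apply LinearEquiv.toLinearMap_injective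
  ext v
  simpa using h v

theorem pull_refl (φ : R →ₐ[k] S) :
    pull φ (LinearEquiv.refl R (R ⊗[k] V)) = LinearEquiv.refl S (S ⊗[k] V) :=
  pull_ext fun v => by simp [pull_tmul]

theorem pull_mul (φ : R →ₐ[k] S) (f g : (R ⊗[k] V) ≃ₗ[R] (R ⊗[k] V)) :
    pull φ (f * g) = pull φ f * pull φ g :=
  pull_ext fun v => by simp [pull_tmul, pull_rTensor, LinearEquiv.mul_apply]

theorem pull_id (f : (R ⊗[k] V) ≃ₗ[R] (R ⊗[k] V)) : pull (AlgHom.id k R) f = f :=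
  pull_ext fun v => by simp [pull_tmul]

theorem pull_comp (φ : R →ₐ[k] S) (ψ : S →ₐ[k] T) (f : (R ⊗[k] V) ≃ₗ[R] (R ⊗[k] V)) :
    pull (ψ.comp φ) f = pull ψ (pull φ f) :=
  pull_ext fun v => by
    simp only [pull_tmul, one_smul, AlgHom.comp_toLinearMap, LinearMap.rTensor_comp,
      LinearMap.comp_apply]

/-- For automorphisms `f` of `R ⊗ V` and `g` of `R ⊗ W`, the automorphism of `R ⊗ (V ⊗ W)` that
corresponds to `f ⊗ g` under `R ⊗ (V ⊗ W) ≃ (R ⊗ V) ⊗_R (R ⊗ W)`. -/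
noncomputable def tensorEquiv (f : (R ⊗[k] V) ≃ₗ[R] (R ⊗[k] V))
    (g : (R ⊗[k] W) ≃ₗ[R] (R ⊗[k] W)) :
    (R ⊗[k] (V ⊗[k] W)) ≃ₗ[R] (R ⊗[k] (V ⊗[k] W)) :=
  (TensorProduct.AlgebraTensorModule.distribBaseChange k R V W).trans
    ((TensorProduct.congr f g).trans
      (TensorProduct.AlgebraTensorModule.distribBaseChange k R V W).symm)

theorem tensorEquiv_refl :
    tensorEquiv (LinearEquiv.refl R (R ⊗[k] V)) (LinearEquiv.refl R (R ⊗[k] W)) =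
      LinearEquiv.refl R _ :=
  pull_ext fun v => by simp [tensorEquiv]

theorem tensorEquiv_mul (f f' : (R ⊗[k] V) ≃ₗ[R] (R ⊗[k] V))
    (g g' : (R ⊗[k] W) ≃ₗ[R] (R ⊗[k] W)) :
    tensorEquiv (f * f') (g * g') = tensorEquiv f g * tensorEquiv f' g' := by
  apply LinearEquiv.toLinearMap_injective
  ext v w
  simp [tensorEquiv, LinearEquiv.mul_apply]

theorem pull_tensorEquiv (φ : R →ₐ[k] S) (f : (R ⊗[k] V) ≃ₗ[R] (R ⊗[k] V))
    (g : (R ⊗[k] W) ≃ₗ[R] (R ⊗[k] W)) :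
    pull φ (tensorEquiv f g) = tensorEquiv (pull φ f) (pull φ g) := by
  have key : ∀ (x : R ⊗[k] V) (y : R ⊗[k] W),
      φ.toLinearMap.rTensor (V ⊗[k] W)
        ((TensorProduct.AlgebraTensorModule.distribBaseChange k R V W).symm (x ⊗ₜ[R] y)) =
      (TensorProduct.AlgebraTensorModule.distribBaseChange k S V W).symm
        (φ.toLinearMap.rTensor V x ⊗ₜ[S] φ.toLinearMap.rTensor W y) := by
    intro x y
    induction x with
    | zero => simp
    | add x x' hx hx' => simp only [TensorProduct.add_tmul, map_add, hx, hx']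
    | tmul a v =>
      induction y with
      | zero => simp
      | add y y' hy hy' => simp only [TensorProduct.tmul_add, map_add, hy, hy']
      | tmul b w => simp
  apply LinearEquiv.toLinearMap_injective
  ext v w
  simp [tensorEquiv, pull_tmul, key]

theorem pull_naturality (φ : R →ₐ[k] S) (f : (R ⊗[k] V) ≃ₗ[R] (R ⊗[k] V))
    (g : (R ⊗[k] W) ≃ₗ[R] (R ⊗[k] W)) (t : V →ₗ[k] W)
    (h : ∀ x, g (t.baseChange R x) = t.baseChange R (f x)) (x : S ⊗[k] V) :
    pull φ g (t.baseChange S x) = t.baseChange S (pull φ f x) := by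
  have key : ∀ y : R ⊗[k] V, φ.toLinearMap.rTensor W (t.baseChange R y) =
      t.baseChange S (φ.toLinearMap.rTensor V y) := by
    intro y
    induction y with
    | zero => simp
    | add y y' hy hy' => simp only [map_add, hy, hy']
    | tmul a v => simp
  induction x with
  | zero => simp
  | add x y hx hy => simp only [map_add, hx, hy]
  | tmul s v =>
    have h1 : g (1 ⊗ₜ t v) = t.baseChange R (f (1 ⊗ₜ v)) := by simpa using h (1 ⊗ₜ v)
    rw [LinearMap.baseChange_tmul, pull_tmul, pull_tmul, h1, key, map_smul]

end BaseChange

section Category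

variable (k : Type u) [Field k] [IsAlgClosed k]
  (A : Type u) [CommRing A] [Algebra k A] [Module.Finite k A] [IsLocalRing A]

/-- The unique `k`-point `s : Spec k → D = Spec A` of a finite local `k`-scheme, `k` algebraically
closed: the projection of `A` onto its residue field, which is `k`. -/
noncomputable def point : A →ₐ[k] k :=
  ((AlgEquiv.ofBijective (Algebra.ofId k (IsLocalRing.ResidueField A))
      IsAlgClosed.algebraMap_bijective_of_isIntegral).symm : _ →ₐ[k] k).comp
    (IsScalarTower.toAlgHom k A (IsLocalRing.ResidueField A))

/-- Objects of the category `𝒮_D`, `D = Spec A`: pairs `(V, β)` of a finite dimensional `k`-vector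
space and an `A`-linear automorphism `β` of `A ⊗ V` with `s^*(β) = id`. -/
structure Obj where
  V : Type u
  [addCommGroup : AddCommGroup V]
  [module : Module k V]
  [finite : Module.Finite k V]
  β : (A ⊗[k] V) ≃ₗ[A] (A ⊗[k] V)
  pull_point : pull (point k A) β = LinearEquiv.refl k (k ⊗[k] V)

attribute [instance] Obj.addCommGroup Obj.module Obj.finite

variable {k A}

/-- Arrows `(V, β) → (V', β')` of `𝒮_D`: linear maps `f : V → V'` with
`β' ∘ (f ⊗ id) = (f ⊗ id) ∘ β`. -/
@[ext]
structure Hom (X Y : Obj k A) where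
  map : X.V →ₗ[k] Y.V
  comm : ∀ x : A ⊗[k] X.V, Y.β (map.baseChange A x) = map.baseChange A (X.β x)

instance : Category (Obj k A) where
  Hom X Y := Hom X Y
  id X := ⟨LinearMap.id, fun x => by simp⟩
  comp f g := ⟨g.map ∘ₗ f.map, fun x => by
    simp only [LinearMap.baseChange_comp, LinearMap.comp_apply, g.comm, f.comm]⟩

/-- The tensor product `(V, β) ⊗ (V', β') = (V ⊗ V', τ(β, β'))` of `𝒮_D`. -/
noncomputable abbrev Obj.tensor (X Y : Obj k A) : Obj k A where
  V := X.V ⊗[k] Y.V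
  β := tensorEquiv X.β Y.β
  pull_point := by rw [pull_tensorEquiv, X.pull_point, Y.pull_point, tensorEquiv_refl]

variable (k A) in
/-- The unit object `(k, id)` of `𝒮_D`. -/
noncomputable abbrev Obj.unit : Obj k A where
  V := k
  β := LinearEquiv.refl A _
  pull_point := pull_refl _

variable (k A) in
/-- `Aut^⊗(σ_D)(R)`: the tensor automorphisms of the functor `(V, β) ↦ R ⊗ V`, that is, of the
forgetful fibre functor `σ_D : 𝒮_D → vect k` with scalars extended to `R`. -/
@[ext]
structure TensorAut (R : Type u) [CommRing R] [Algebra k R] where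
  app : ∀ X : Obj k A, (R ⊗[k] X.V) ≃ₗ[R] (R ⊗[k] X.V)
  naturality : ∀ {X Y : Obj k A} (f : X ⟶ Y) (x : R ⊗[k] X.V),
    app Y (f.map.baseChange R x) = f.map.baseChange R (app X x)
  app_unit : app (Obj.unit k A) = LinearEquiv.refl R _
  app_tensor : ∀ X Y : Obj k A, app (X.tensor Y) = tensorEquiv (app X) (app Y)

namespace TensorAut

variable {R S : Type u} [CommRing R] [Algebra k R] [CommRing S] [Algebra k S]

noncomputable instance : Mul (TensorAut k A R) where
  mul a b :=
    { app := fun X => a.app X * b.app X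
      naturality := fun f x => by
        simp only [LinearEquiv.mul_apply, b.naturality, a.naturality]
      app_unit := by rw [a.app_unit, b.app_unit]; rfl
      app_tensor := fun X Y => by rw [a.app_tensor, b.app_tensor]; exact (tensorEquiv_mul _ _ _ _).symm }

noncomputable instance : One (TensorAut k A R) where
  one :=
    { app := fun _ => 1
      naturality := fun _ _ => rfl
      app_unit := rfl
      app_tensor := fun _ _ => tensorEquiv_refl.symm }

noncomputable instance : Inv (TensorAut k A R) where
  inv a :=
    { app := fun X => (a.app X)⁻¹
      naturality := fun {X Y} f x => by
        change (a.app Y).symm _ = _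
        rw [LinearEquiv.symm_apply_eq, a.naturality]
        change _ = f.map.baseChange R (a.app X ((a.app X).symm x))
        rw [LinearEquiv.apply_symm_apply]
      app_unit := by rw [a.app_unit]; rfl
      app_tensor := fun X Y => by
        rw [a.app_tensor, inv_eq_iff_mul_eq_one, ← tensorEquiv_mul, mul_inv_cancel,
          mul_inv_cancel]
        exact tensorEquiv_refl }

/-- Composition of tensor automorphisms. -/
noncomputable instance : Group (TensorAut k A R) where
  mul_assoc a b c := TensorAut.ext (funext fun X => mul_assoc _ _ _)
  one_mul a := TensorAut.ext (funext fun X => one_mul _)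
  mul_one a := TensorAut.ext (funext fun X => mul_one _)
  inv_mul_cancel a := TensorAut.ext (funext fun X => inv_mul_cancel _)

/-- Extension of scalars of tensor automorphisms along `φ : R → S`. -/
noncomputable def extend (φ : R →ₐ[k] S) : TensorAut k A R →* TensorAut k A S where
  toFun a :=
    { app := fun X => pull φ (a.app X)
      naturality := fun f x => pull_naturality φ _ _ f.map (a.naturality f) x
      app_unit := by rw [a.app_unit]; exact pull_refl φ
      app_tensor := fun X Y => by rw [a.app_tensor]; exact pull_tensorEquiv φ _ _ }
  map_one' := TensorAut.ext (funext fun X => pull_refl φ)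
  map_mul' a b := TensorAut.ext (funext fun X => pull_mul φ _ _)

theorem extend_id : extend (AlgHom.id k R) = MonoidHom.id (TensorAut k A R) :=
  MonoidHom.ext fun _ => TensorAut.ext (funext fun _ => pull_id _)

theorem extend_comp {T : Type u} [CommRing T] [Algebra k T] (φ : R →ₐ[k] S) (ψ : S →ₐ[k] T) :
    (extend (ψ.comp φ) : TensorAut k A R →* _) = (extend ψ).comp (extend φ) :=
  MonoidHom.ext fun _ => TensorAut.ext (funext fun _ => pull_comp φ ψ _)

end TensorAut

variable (k A) in
/-- The group functor `Σ_D = Aut^⊗(σ_D)` attached by Tannakian duality to `𝒮_D` and its fibre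
functor `σ_D`, for `D = Spec A`. -/
noncomputable def tannakaGroup : CommAlgCat.{u} k ⥤ GrpCat.{u + 1} where
  obj R := GrpCat.of (TensorAut k A R)
  map φ := GrpCat.ofHom (TensorAut.extend φ.hom)
  map_id _ := congrArg GrpCat.ofHom TensorAut.extend_id
  map_comp φ ψ := congrArg GrpCat.ofHom (TensorAut.extend_comp φ.hom ψ.hom)

end Category

section GroupFunctors

variable {k : Type u} [Field k]

/-- A group functor on commutative `k`-algebras is a local (affine) group scheme if it is
represented by a commutative `k`-algebra `H` such that `Spec H` has exactly one closed point.
(By the Yoneda lemma `H` is unique up to unique isomorphism, and it is a Hopf algebra.) -/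
def IsLocalGroupScheme (G : CommAlgCat.{u} k ⥤ GrpCat.{w}) : Prop :=
  ∃ H : CommAlgCat.{u} k, Nonempty ((G ⋙ forget GrpCat).CorepresentableBy H) ∧
    ∃! x : PrimeSpectrum H, IsClosed ({x} : Set (PrimeSpectrum H))

variable (p : ℕ) [Fact p.Prime] [CharP k p]

/-- The ring `R` with scalars restricted along `Fr^n : k → k`, i.e. `c` acts by `c ^ (p ^ n)`.
For a group functor `G`, the Frobenius twist is `G^{(p^n)}(R) = G (frobTwist p n R)`. -/
noncomputable def frobTwist (n : ℕ) (R : CommAlgCat.{u} k) : CommAlgCat.{u} k :=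
  @CommAlgCat.of k _ R _ (((algebraMap k R).comp (iterateFrobenius k p n)).toAlgebra)

/-- `Fr^n : R → R`, `r ↦ r ^ (p ^ n)`, as a morphism of `k`-algebras to the twist of `R`. -/
noncomputable def frobHom (n : ℕ) (R : CommAlgCat.{u} k) : R ⟶ frobTwist p n R :=
  @CommAlgCat.ofHom k _ R (frobTwist p n R) _ _ _ _
    { toFun := fun r => (r ^ (p ^ n) : R)
      map_one' := one_pow (M := R) _
      map_mul' := fun x y => mul_pow (M := R) x y _
      map_zero' := zero_pow (M₀ := R) (pow_ne_zero _ (Fact.out : p.Prime).ne_zero)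
      map_add' := fun x y => by
        rcases subsingleton_or_nontrivial (R : Type u) with h | h
        · exact h.elim _ _
        · have : CharP R p := charP_of_injective_algebraMap (algebraMap k R).injective p
          exact add_pow_char_pow (R := R) x y p n
      commutes' := fun c => by
        change (algebraMap k R c) ^ (p ^ n) = algebraMap k R (iterateFrobenius k p n c)
        rw [iterateFrobenius_def, map_pow] }

/-- `G` is annihilated by `Fr^n`: the `n`-fold Frobenius morphism `Fr^n : G → G^{(p^n)}`, which on
`R`-points is `G` applied to `Fr^n : R → frobTwist p n R`, is the trivial homomorphism. -/
def KilledByFrob (G : CommAlgCat.{u} k ⥤ GrpCat.{w}) (n : ℕ) : Prop :=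
  ∀ (R : CommAlgCat.{u} k) (x : G.obj R), G.map (frobHom p n R) x = 1

/-- The height of `G` is `h`: it is the least `n` for which `Fr^n` annihilates `G`. -/
def HasHeight (G : CommAlgCat.{u} k ⥤ GrpCat.{w}) (h : ℕ) : Prop :=
  IsLeast {n : ℕ | KilledByFrob p G n} h

end GroupFunctors

/-- The ideal `𝔞^{[q]}` generated by the `q`-th powers of the elements of `𝔞`. -/
def frobPower {A : Type u} [CommRing A] (I : Ideal A) (q : ℕ) : Ideal A :=
  Ideal.span ((fun a => a ^ q) '' (I : Set A))

end SigmaD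

/-! The maps `β` themselves form a tensor automorphism over `A`, trivial at the closed point. Its
pullbacks along the `r` embeddings `A → A^{⊗r}` multiply to a "word" over `A^{⊗r}`, and these words
suffice to describe `Σ_D`. The candidate coordinate ring `coordRing` is the set of families of
matrix coefficients of all words in `∏_r A^{⊗r}`; tensor products and direct sums of objects make it
a subalgebra.

The crux is `coeff_eq_zero_of_matrixCoeff`. For a fixed form `ξ`, the vectors `v` whose coefficient
vanishes on every word form a subspace stable under `β`, since lengthening a word by one letter
replaces `v` by its `β`-components. This subspace is therefore a subobject, and `ξ` kills it because
the empty word is the identity. Naturality along the inclusion then makes the coefficient vanish on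
every tensor automorphism. So evaluation at a tensor automorphism is a well-defined homomorphism on
`coordRing`, inverse to specializing the universal automorphism.

Frobenius controls the rest. If `a ^ p ^ n = 0` on `𝔪`, every `p ^ n`-th power in `A^{⊗r}` is a
scalar, uniformly in `r` (`matrixCoeff_pow`). Hence the augmentation ideal of `coordRing` is nil,
which gives locality and the invertibility of the universal matrices, and `Fr^n` is trivial.
Conversely, the objects `(k², 1 + aN)` have `a` as a coefficient of the tautological point, so
triviality of `Fr^n` forces `a ^ p ^ n = 0`. -/

namespace SigmaD

/-! ### Linear forms as matrix entries over `R` -/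

section EvalDual

variable {k : Type u} [Field k] {R S : Type u} [CommRing R] [CommRing S]
  [Algebra k R] [Algebra k S]
  {V W : Type u} [AddCommGroup V] [Module k V] [AddCommGroup W] [Module k W]

variable (R) in
/-- The `R`-linear extension `R ⊗ V → R` of a linear form on `V`. -/
noncomputable def evalDual (ξ : Module.Dual k V) : R ⊗[k] V →ₗ[R] R :=
  LinearMap.liftBaseChange R (Algebra.linearMap k R ∘ₗ ξ)

@[simp]
theorem evalDual_tmul (ξ : Module.Dual k V) (r : R) (v : V) :
    evalDual R ξ (r ⊗ₜ v) = r * algebraMap k R (ξ v) := by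
  simp [evalDual]

theorem evalDual_add (ξ η : Module.Dual k V) (x : R ⊗[k] V) :
    evalDual R (ξ + η) x = evalDual R ξ x + evalDual R η x := by
  have : evalDual R (ξ + η) = evalDual R ξ + evalDual R η := by
    ext v; simp
  rw [this, LinearMap.add_apply]

theorem evalDual_smul (c : k) (ξ : Module.Dual k V) (x : R ⊗[k] V) :
    evalDual R (c • ξ) x = c • evalDual R ξ x := by
  have : evalDual R (c • ξ) = c • evalDual R ξ := by
    ext v; simp [Algebra.smul_def]
  rw [this, LinearMap.smul_apply]

theorem evalDual_baseChange (t : V →ₗ[k] W) (ξ : Module.Dual k W) (x : R ⊗[k] V) :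
    evalDual R ξ (t.baseChange R x) = evalDual R (ξ ∘ₗ t) x := by
  induction x with
  | zero => simp
  | add x y hx hy => simp only [map_add, hx, hy]
  | tmul r v => simp

theorem evalDual_rTensor (φ : R →ₐ[k] S) (ξ : Module.Dual k V) (x : R ⊗[k] V) :
    evalDual S ξ (φ.toLinearMap.rTensor V x) = φ (evalDual R ξ x) := by
  induction x with
  | zero => simp
  | add x y hx hy => simp only [map_add, hx, hy]
  | tmul r v => simp

/-- For `V` finite dimensional, the linear forms on `V` separate the elements of `R ⊗ V`. -/
theorem evalDual_separating [Module.Finite k V] {x y : R ⊗[k] V}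
    (h : ∀ ξ : Module.Dual k V, evalDual R ξ x = evalDual R ξ y) : x = y := by
  let b := Module.finBasis k V
  have hb : ∀ i, evalDual R (b.coord i) = (b.baseChange R).coord i := fun i => by
    ext v; simp [Algebra.smul_def]
  refine (b.baseChange R).ext_elem fun i => ?_
  have := h (b.coord i)
  rwa [hb] at this

theorem evalDual_dualDistrib (ξ : Module.Dual k V) (η : Module.Dual k W) (x : R ⊗[k] V)
    (y : R ⊗[k] W) :
    evalDual R (TensorProduct.dualDistrib k V W (ξ ⊗ₜ η))
      ((TensorProduct.AlgebraTensorModule.distribBaseChange k R V W).symm (x ⊗ₜ[R] y)) =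
      evalDual R ξ x * evalDual R η y := by
  induction x with
  | zero => simp
  | add x x' hx hx' => simp only [TensorProduct.add_tmul, map_add, hx, hx', add_mul]
  | tmul a v =>
    induction y with
    | zero => simp
    | add y y' hy hy' => simp only [TensorProduct.tmul_add, map_add, hy, hy', mul_add]
    | tmul b w => simp; ring

theorem evalDual_tensorEquiv (f : (R ⊗[k] V) ≃ₗ[R] (R ⊗[k] V)) (g : (R ⊗[k] W) ≃ₗ[R] (R ⊗[k] W))
    (ξ : Module.Dual k V) (η : Module.Dual k W) (v : V) (w : W) :
    evalDual R (TensorProduct.dualDistrib k V W (ξ ⊗ₜ η)) (tensorEquiv f g (1 ⊗ₜ (v ⊗ₜ w))) =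
      evalDual R ξ (f (1 ⊗ₜ v)) * evalDual R η (g (1 ⊗ₜ w)) := by
  rw [← evalDual_dualDistrib]
  simp [tensorEquiv]

/-- In finite dimension the products `ξ ⊗ η` span the dual of `V ⊗ W`, and `evalDual` is additive in
the form. -/
theorem evalDual_separating_tensor [Module.Finite k V] [Module.Finite k W]
    {x y : R ⊗[k] (V ⊗[k] W)}
    (h : ∀ (ξ : Module.Dual k V) (η : Module.Dual k W),
      evalDual R (TensorProduct.dualDistrib k V W (ξ ⊗ₜ η)) x =
        evalDual R (TensorProduct.dualDistrib k V W (ξ ⊗ₜ η)) y) : x = y := by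
  refine evalDual_separating fun ζ => ?_
  obtain ⟨z, rfl⟩ : ∃ z, TensorProduct.dualDistrib k V W z = ζ :=
    (TensorProduct.dualDistribEquiv k V W).surjective ζ
  induction z with
  | zero =>
    have h0 := evalDual_smul (R := R) (0 : k) (0 : Module.Dual k (V ⊗[k] W))
    simp only [zero_smul] at h0
    simp only [map_zero, h0]
  | add z z' hz hz' => simp only [map_add, evalDual_add, hz, hz']
  | tmul ξ η => exact h ξ η

/-- The block diagonal automorphism of `A ⊗ (V × W)`. -/
noncomputable def prodEquiv (f : (R ⊗[k] V) ≃ₗ[R] (R ⊗[k] V)) (g : (R ⊗[k] W) ≃ₗ[R] (R ⊗[k] W)) :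
    (R ⊗[k] (V × W)) ≃ₗ[R] (R ⊗[k] (V × W)) :=
  (TensorProduct.prodRight k R R V W).trans
    ((f.prodCongr g).trans (TensorProduct.prodRight k R R V W).symm)

theorem prodEquiv_inl (f : (R ⊗[k] V) ≃ₗ[R] (R ⊗[k] V)) (g : (R ⊗[k] W) ≃ₗ[R] (R ⊗[k] W))
    (x : R ⊗[k] V) :
    prodEquiv f g ((LinearMap.inl k V W).baseChange R x) =
      (LinearMap.inl k V W).baseChange R (f x) := by
  have key : ∀ y : R ⊗[k] V, TensorProduct.prodRight k R R V W
      ((LinearMap.inl k V W).baseChange R y) = (y, 0) := fun y => by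
    induction y with
    | zero => simp only [map_zero, Prod.mk_zero_zero]
    | add y z hy hz => simp only [map_add, hy, hz, Prod.mk_add_mk, add_zero]
    | tmul r v => simp
  rw [prodEquiv, LinearEquiv.trans_apply, LinearEquiv.trans_apply, key,
    LinearEquiv.symm_apply_eq, key]
  simp

theorem prodEquiv_inr (f : (R ⊗[k] V) ≃ₗ[R] (R ⊗[k] V)) (g : (R ⊗[k] W) ≃ₗ[R] (R ⊗[k] W))
    (x : R ⊗[k] W) :
    prodEquiv f g ((LinearMap.inr k V W).baseChange R x) =
      (LinearMap.inr k V W).baseChange R (g x) := by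
  have key : ∀ y : R ⊗[k] W, TensorProduct.prodRight k R R V W
      ((LinearMap.inr k V W).baseChange R y) = (0, y) := fun y => by
    induction y with
    | zero => simp only [map_zero, Prod.mk_zero_zero]
    | add y z hy hz => simp only [map_add, hy, hz, Prod.mk_add_mk, add_zero]
    | tmul r v => simp
  rw [prodEquiv, LinearEquiv.trans_apply, LinearEquiv.trans_apply, key,
    LinearEquiv.symm_apply_eq, key]
  simp

end EvalDual

/-! ### Matrix coefficients, direct sums and the tautological automorphism -/

section Coefficients

variable {k : Type u} [Field k] [IsAlgClosed k]
  {A : Type u} [CommRing A] [Algebra k A] [Module.Finite k A] [IsLocalRing A]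
  {R S : Type u} [CommRing R] [Algebra k R] [CommRing S] [Algebra k S]

/-- The matrix coefficient of a tensor automorphism at an object `X`, a vector and a linear
form. -/
noncomputable def TensorAut.coeff (x : TensorAut k A R) (X : Obj k A) :
    X.V →ₗ[k] Module.Dual k X.V →ₗ[k] R :=
  LinearMap.mk₂ k (fun v ξ => evalDual R ξ (x.app X (1 ⊗ₜ v)))
    (fun v w ξ => by simp only [TensorProduct.tmul_add, map_add])
    (fun c v ξ => by
      rw [TensorProduct.tmul_smul, ← algebraMap_smul R c, map_smul, map_smul, algebraMap_smul])
    (fun v ξ η => evalDual_add _ _ _)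
    (fun c v ξ => evalDual_smul _ _ _)

namespace TensorAut

theorem coeff_apply (x : TensorAut k A R) (X : Obj k A) (v : X.V) (ξ : Module.Dual k X.V) :
    x.coeff X v ξ = evalDual R ξ (x.app X (1 ⊗ₜ v)) := rfl

theorem ext_coeff {x y : TensorAut k A R} (h : ∀ X v ξ, x.coeff X v ξ = y.coeff X v ξ) :
    x = y :=
  TensorAut.ext (funext fun X => pull_ext fun v => evalDual_separating fun ξ => h X v ξ)

theorem coeff_one (X : Obj k A) (v : X.V) (ξ : Module.Dual k X.V) :
    (1 : TensorAut k A R).coeff X v ξ = algebraMap k R (ξ v) := by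
  change evalDual R ξ (1 ⊗ₜ v) = _
  simp

theorem coeff_extend (φ : R →ₐ[k] S) (x : TensorAut k A R) (X : Obj k A) (v : X.V)
    (ξ : Module.Dual k X.V) : (extend φ x).coeff X v ξ = φ (x.coeff X v ξ) := by
  change evalDual S ξ (pull φ (x.app X) (1 ⊗ₜ v)) = _
  rw [pull_tmul, one_smul, evalDual_rTensor, coeff_apply]

theorem coeff_naturality (x : TensorAut k A R) {X Y : Obj k A} (f : X ⟶ Y) (v : X.V)
    (ξ : Module.Dual k Y.V) : x.coeff Y (f.map v) ξ = x.coeff X v (ξ ∘ₗ f.map) := by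
  rw [coeff_apply, coeff_apply, ← evalDual_baseChange, ← x.naturality, LinearMap.baseChange_tmul]

theorem coeff_unit (x : TensorAut k A R) (c : k) (ξ : Module.Dual k k) :
    x.coeff (Obj.unit k A) c ξ = algebraMap k R (ξ c) := by
  rw [coeff_apply, x.app_unit]
  simp

theorem coeff_tensor (x : TensorAut k A R) (X Y : Obj k A) (v : X.V) (w : Y.V)
    (ξ : Module.Dual k X.V) (η : Module.Dual k Y.V) :
    x.coeff (X.tensor Y) (v ⊗ₜ w) (TensorProduct.dualDistrib k X.V Y.V (ξ ⊗ₜ η)) =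
      x.coeff X v ξ * x.coeff Y w η := by
  rw [coeff_apply, x.app_tensor]
  exact evalDual_tensorEquiv _ _ _ _ _ _

end TensorAut

/-- The direct sum of two objects of `𝒮_D`. -/
noncomputable abbrev Obj.prod (X Y : Obj k A) : Obj k A where
  V := X.V × Y.V
  β := prodEquiv X.β Y.β
  pull_point := pull_ext fun v => by
    have h : (1 : k) ⊗ₜ[k] v = (LinearMap.inl k X.V Y.V).baseChange k (1 ⊗ₜ v.1) +
        (LinearMap.inr k X.V Y.V).baseChange k (1 ⊗ₜ v.2) := by
      simp [← TensorProduct.tmul_add]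
    rw [h, map_add, pull_naturality (point k A) X.β _ _ (prodEquiv_inl X.β Y.β),
      pull_naturality (point k A) Y.β _ _ (prodEquiv_inr X.β Y.β), X.pull_point, Y.pull_point]
    rfl

/-- The inclusion of the first summand. -/
noncomputable def Obj.inl (X Y : Obj k A) : X ⟶ X.prod Y where
  map := LinearMap.inl k X.V Y.V
  comm := prodEquiv_inl X.β Y.β

/-- The inclusion of the second summand. -/
noncomputable def Obj.inr (X Y : Obj k A) : Y ⟶ X.prod Y where
  map := LinearMap.inr k X.V Y.V
  comm := prodEquiv_inr X.β Y.β

/-- Naturality along the two inclusions gives this. It makes the set of coefficients closed under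
addition, as `coeff_tensor` does for multiplication. -/
theorem TensorAut.coeff_prod (x : TensorAut k A R) (X Y : Obj k A) (v : X.V) (w : Y.V)
    (ξ : Module.Dual k X.V) (η : Module.Dual k Y.V) :
    x.coeff (X.prod Y) (v, w) (LinearMap.coprod ξ η) = x.coeff X v ξ + x.coeff Y w η := by
  have h : ((v, w) : (X.prod Y).V) = (Obj.inl X Y).map v + (Obj.inr X Y).map w := by
    change ((v, w) : X.V × Y.V) = (v, 0) + (0, w)
    rw [Prod.mk_add_mk, add_zero, zero_add]
  rw [h, map_add, LinearMap.add_apply, x.coeff_naturality, x.coeff_naturality]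
  congr 2
  · exact LinearMap.coprod_inl ξ η
  · exact LinearMap.coprod_inr ξ η

/-! ### Subobjects cut out by `β`-stable subspaces -/

section Subobject

variable (X : Obj k A) (W : Submodule k X.V)

/-- The component of `β` along a linear form on `A`, an endomorphism of `V`. -/
noncomputable def Obj.component (l : Module.Dual k A) : X.V →ₗ[k] X.V :=
  TensorProduct.lid k X.V ∘ₗ l.rTensor X.V ∘ₗ X.β.toLinearMap.restrictScalars k ∘ₗ
    TensorProduct.mk k A X.V 1

theorem Obj.sum_component {ι : Type*} [Fintype ι] (b : Module.Basis ι k A) (v : X.V) :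
    X.β (1 ⊗ₜ v) = ∑ i, b i ⊗ₜ X.component (b.coord i) v := by
  have key : ∀ z : A ⊗[k] X.V,
      z = ∑ i, b i ⊗ₜ TensorProduct.lid k X.V ((b.coord i).rTensor X.V z) := fun z => by
    induction z with
    | zero => simp
    | add y z hy hz =>
      conv_lhs => rw [hy, hz]
      simp only [map_add, TensorProduct.tmul_add, Finset.sum_add_distrib]
    | tmul a v =>
      simp only [LinearMap.rTensor_tmul, TensorProduct.lid_tmul, TensorProduct.tmul_smul,
        TensorProduct.smul_tmul', Module.Basis.coord_apply, ← TensorProduct.sum_tmul, b.sum_repr]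
  exact key _

/-- Stability under the components means that `β` maps `A ⊗ W` into itself. The restriction inherits
injectivity from `β`, and `A ⊗ W` is finite-dimensional over `k`, so it is bijective. -/
theorem Obj.exists_restrict (hW : ∀ l : Module.Dual k A, ∀ w ∈ W, X.component l w ∈ W) :
    ∃ g : (A ⊗[k] W) ≃ₗ[A] (A ⊗[k] W),
    ∀ x, X.β (W.subtype.baseChange A x) = W.subtype.baseChange A (g x) := by
  let b := Module.finBasis k A
  let f : A ⊗[k] W →ₗ[A] A ⊗[k] W := LinearMap.liftBaseChange A
    (∑ i, TensorProduct.mk k A W (b i) ∘ₗ (X.component (b.coord i)).restrict (hW (b.coord i)))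
  have hf : ∀ x, X.β (W.subtype.baseChange A x) = W.subtype.baseChange A (f x) := fun x => by
    induction x with
    | zero => simp
    | add y z hy hz => simp only [map_add, hy, hz]
    | tmul a w =>
      have : (a ⊗ₜ[k] (w : X.V) : A ⊗[k] X.V) = a • ((1 : A) ⊗ₜ[k] (w : X.V)) := by
        simp [TensorProduct.smul_tmul']
      simp [f, this, X.sum_component b, LinearMap.sum_apply, Finset.smul_sum]
  have hj : Function.Injective (W.subtype.baseChange A) :=
    Module.Flat.lTensor_preserves_injective_linearMap (M := A) W.subtype W.injective_subtype
  have hfi : Function.Injective f := fun x y hxy => hj (X.β.injective (by rw [hf, hf, hxy]))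
  have hfs : Function.Surjective f :=
    (LinearMap.injective_iff_surjective (K := k) (f := f.restrictScalars k)).1 hfi
  exact ⟨LinearEquiv.ofBijective f ⟨hfi, hfs⟩, hf⟩

variable (hW : ∀ l : Module.Dual k A, ∀ w ∈ W, X.component l w ∈ W)

/-- The subobject carried by a subspace stable under all components of `β`. -/
noncomputable def Obj.sub : Obj k A where
  V := W
  β := (X.exists_restrict W hW).choose
  pull_point := LinearEquiv.ext fun x => by
    have hj : Function.Injective (W.subtype.baseChange k) :=
      Module.Flat.lTensor_preserves_injective_linearMap (M := k) W.subtype W.injective_subtype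
    apply hj
    rw [← pull_naturality (point k A) _ X.β _ (X.exists_restrict W hW).choose_spec,
      X.pull_point]
    rfl

/-- The inclusion of a subobject. -/
noncomputable def Obj.subι : X.sub W hW ⟶ X where
  map := W.subtype
  comm := (X.exists_restrict W hW).choose_spec

end Subobject

/-- The automorphisms `β` form a tensor automorphism over `A`. -/
noncomputable def tautological : TensorAut k A A where
  app X := X.β
  naturality f x := Hom.comm f x
  app_unit := rfl
  app_tensor _ _ := rfl

theorem extend_point_tautological :
    TensorAut.extend (point k A) (tautological : TensorAut k A A) = 1 :=
  TensorAut.ext (funext fun X => X.pull_point)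

/-- The product, over `A ⊗ R`, of a tensor automorphism over `R` and the tautological one. -/
noncomputable def TensorAut.mulTautological (x : TensorAut k A R) : TensorAut k A (A ⊗[k] R) :=
  extend Algebra.TensorProduct.includeRight x *
    extend Algebra.TensorProduct.includeLeft tautological

/-- The tautological factor acts first, so it only replaces `v` by its components under `β`; the
form and `x` are untouched. -/
theorem TensorAut.coeff_mulTautological (x : TensorAut k A R) {ι : Type*} [Fintype ι]
    (b : Module.Basis ι k A) (X : Obj k A) (v : X.V) (ξ : Module.Dual k X.V) :
    x.mulTautological.coeff X v ξ =
      ∑ i, b i ⊗ₜ x.coeff X (X.component (b.coord i) v) ξ := by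
  rw [coeff_apply]
  change evalDual _ ξ (pull _ (x.app X) (pull _ X.β (1 ⊗ₜ v))) = _
  rw [pull_tmul, one_smul, X.sum_component b]
  simp only [map_sum, LinearMap.rTensor_tmul, pull_tmul, map_smul, evalDual_rTensor, coeff_apply]
  refine Finset.sum_congr rfl fun i _ => ?_
  simp

theorem TensorAut.extend_lift_mulTautological (ε : R →ₐ[k] k) (x : TensorAut k A R)
    (hx : extend ε x = 1) :
    extend (Algebra.TensorProduct.lift (point k A) ε fun _ _ => Commute.all _ _)
      x.mulTautological = 1 := by
  rw [mulTautological, map_mul, ← MonoidHom.comp_apply, ← MonoidHom.comp_apply, ← extend_comp,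
    ← extend_comp]
  have hr : (Algebra.TensorProduct.lift (point k A) ε fun _ _ => Commute.all _ _).comp
      Algebra.TensorProduct.includeRight = ε := AlgHom.ext fun r => by simp
  have hl : (Algebra.TensorProduct.lift (point k A) ε fun _ _ => Commute.all _ _).comp
      Algebra.TensorProduct.includeLeft = point k A := AlgHom.ext fun a => by simp
  rw [hr, hl, hx, extend_point_tautological, one_mul]

end Coefficients

end SigmaD

namespace SigmaD

/-! ### Reconstructing a tensor automorphism from its coefficients -/

section OfCoeff

variable {k : Type u} [Field k] [IsAlgClosed k]
  {A : Type u} [CommRing A] [Algebra k A] [Module.Finite k A] [IsLocalRing A]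
  {R : Type u} [CommRing R] [Algebra k R]
  (c : ∀ X : Obj k A, X.V →ₗ[k] Module.Dual k X.V →ₗ[k] R)

/-- The endomorphism of `R ⊗ V` with prescribed matrix coefficients. -/
noncomputable def homOfCoeff (X : Obj k A) : R ⊗[k] X.V →ₗ[R] R ⊗[k] X.V :=
  LinearMap.liftBaseChange R (∑ i, (TensorProduct.mk k R X.V).flip
    (Module.finBasis k X.V i) ∘ₗ (c X).flip ((Module.finBasis k X.V).coord i))

theorem homOfCoeff_one_tmul (X : Obj k A) (v : X.V) :
    homOfCoeff c X (1 ⊗ₜ v) = ∑ i, c X v ((Module.finBasis k X.V).coord i) ⊗ₜ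
      Module.finBasis k X.V i := by
  simp [homOfCoeff, LinearMap.sum_apply]

theorem evalDual_homOfCoeff (X : Obj k A) (v : X.V) (ξ : Module.Dual k X.V) :
    evalDual R ξ (homOfCoeff c X (1 ⊗ₜ v)) = c X v ξ := by
  rw [homOfCoeff_one_tmul]
  conv_rhs => rw [← (Module.finBasis k X.V).sum_dual_apply_smul_coord ξ]
  simp only [map_sum, evalDual_tmul, map_smul, Algebra.smul_def, mul_comm]

theorem toMatrix_homOfCoeff (X : Obj k A) :
    LinearMap.toMatrix ((Module.finBasis k X.V).baseChange R)
      ((Module.finBasis k X.V).baseChange R) (homOfCoeff c X) =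
      Matrix.of fun i j => c X (Module.finBasis k X.V j) ((Module.finBasis k X.V).coord i) := by
  ext i j
  rw [LinearMap.toMatrix_apply, Module.Basis.baseChange_apply, homOfCoeff_one_tmul]
  simp [Finsupp.finsetSum_apply, Finsupp.single_apply]

/-- The tensor automorphism over `R` with prescribed matrix coefficients. -/
noncomputable def TensorAut.ofCoeff
    (naturality : ∀ {X Y : Obj k A} (f : X ⟶ Y) (v : X.V) (ξ : Module.Dual k Y.V),
      c Y (f.map v) ξ = c X v (ξ ∘ₗ f.map))
    (unit : ∀ (a : k) (ξ : Module.Dual k k), c (Obj.unit k A) a ξ = algebraMap k R (ξ a))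
    (tensor : ∀ (X Y : Obj k A) (v : X.V) (w : Y.V) (ξ : Module.Dual k X.V)
      (η : Module.Dual k Y.V), c (X.tensor Y) (v ⊗ₜ w)
        (TensorProduct.dualDistrib k X.V Y.V (ξ ⊗ₜ η)) = c X v ξ * c Y w η)
    (isUnit_det : ∀ X : Obj k A, IsUnit (Matrix.of fun i j =>
      c X (Module.finBasis k X.V j) ((Module.finBasis k X.V).coord i)).det) :
    TensorAut k A R :=
  have hu : ∀ X, IsUnit (LinearMap.toMatrix ((Module.finBasis k X.V).baseChange R)
      ((Module.finBasis k X.V).baseChange R) (homOfCoeff c X)).det := fun X => by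
    rw [toMatrix_homOfCoeff]
    exact isUnit_det X
  have he : ∀ X v ξ, evalDual R ξ (LinearEquiv.ofIsUnitDet (hu X) (1 ⊗ₜ v)) = c X v ξ :=
    evalDual_homOfCoeff c
  { app := fun X => LinearEquiv.ofIsUnitDet (hu X)
    naturality := fun {X Y} f x => by
      induction x with
      | zero => simp only [map_zero]
      | add x y hx hy => simp only [map_add, hx, hy]
      | tmul a v =>
        have h : (a ⊗ₜ[k] v : R ⊗[k] X.V) = a • ((1 : R) ⊗ₜ[k] v) := by
          simp [TensorProduct.smul_tmul']
        rw [h]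
        simp only [map_smul]
        congr 1
        refine evalDual_separating fun ξ => ?_
        rw [LinearMap.baseChange_tmul, he, evalDual_baseChange, he, naturality]
    app_unit := pull_ext fun a => evalDual_separating fun ξ => by
      rw [he, unit]
      simp
    app_tensor := fun X Y => by
      apply LinearEquiv.toLinearMap_injective
      ext v w
      refine evalDual_separating_tensor fun ξ η => ?_
      exact (he (X.tensor Y) _ _).trans ((tensor X Y v w ξ η).trans
        (by rw [← he, ← he]; exact (evalDual_tensorEquiv _ _ _ _ _ _).symm)) }

theorem TensorAut.coeff_ofCoeff (naturality) (unit) (tensor) (isUnit_det) (X : Obj k A) (v : X.V)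
    (ξ : Module.Dual k X.V) :
    (TensorAut.ofCoeff c naturality unit tensor isUnit_det).coeff X v ξ = c X v ξ :=
  evalDual_homOfCoeff c X v ξ

end OfCoeff

/-! ### The coordinate ring built from words -/

section CoordinateRing

variable (k : Type u) [Field k] [IsAlgClosed k]
  (A : Type u) [CommRing A] [Algebra k A] [Module.Finite k A] [IsLocalRing A]

/-- The tensor powers `A ⊗ (A ⊗ ⋯ ⊗ k)` of `A`. -/
noncomputable def tensorPower : ℕ → CommAlgCat.{u} k
  | 0 => CommAlgCat.of k k
  | r + 1 => CommAlgCat.of k (A ⊗[k] tensorPower r)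

/-- The product of the pullbacks of the tautological tensor automorphism along the `r` embeddings
of `A` into its `r`-th tensor power. -/
noncomputable def word : ∀ r, TensorAut k A (tensorPower k A r)
  | 0 => (1 : TensorAut k A k)
  | r + 1 => (word r).mulTautological

/-- The augmentation of the tensor powers of `A` induced by `point k A`. -/
noncomputable def augmentation : ∀ r, tensorPower k A r →ₐ[k] k
  | 0 => AlgHom.id k k
  | r + 1 => Algebra.TensorProduct.lift (point k A) (augmentation r) fun _ _ => Commute.all _ _

theorem extend_augmentation_word (r : ℕ) :
    TensorAut.extend (augmentation k A r) (word k A r) = 1 := by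
  induction r with
  | zero => exact map_one _
  | succ r ih => exact (word k A r).extend_lift_mulTautological _ ih

theorem augmentation_coeff_word (r : ℕ) (X : Obj k A) (v : X.V) (ξ : Module.Dual k X.V) :
    augmentation k A r ((word k A r).coeff X v ξ) = ξ v := by
  rw [← TensorAut.coeff_extend, extend_augmentation_word, TensorAut.coeff_one]
  rfl

variable {k A} in
theorem sub_point_mem (a : A) : a - algebraMap k A (point k A a) ∈ IsLocalRing.maximalIdeal A := by
  rw [← IsLocalRing.ker_residue, RingHom.mem_ker, map_sub, sub_eq_zero]
  have h : ∀ c : IsLocalRing.ResidueField A, algebraMap k (IsLocalRing.ResidueField A)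
      ((AlgEquiv.ofBijective (Algebra.ofId k (IsLocalRing.ResidueField A))
        IsAlgClosed.algebraMap_bijective_of_isIntegral).symm c) = c := fun c =>
    (AlgEquiv.ofBijective (Algebra.ofId k (IsLocalRing.ResidueField A))
        IsAlgClosed.algebraMap_bijective_of_isIntegral).apply_symm_apply c
  exact (h _).symm

variable {k A} in
theorem point_eq_zero {a : A} (ha : a ∈ IsLocalRing.maximalIdeal A) : point k A a = 0 := by
  by_contra h
  -- The scalar `point k A a` would lie in `𝔪`, yet a nonzero scalar is a unit.
  have h1 := Ideal.sub_mem _ ha (sub_point_mem (k := k) a)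
  rw [sub_sub_cancel] at h1
  exact (IsLocalRing.mem_maximalIdeal _).1 h1 ((IsUnit.mk0 _ h).map (algebraMap k A))

/-! ### Frobenius powers in the tensor powers of `A` -/

section Frobenius

variable {k A} (p : ℕ) [Fact p.Prime] [CharP k p] {n : ℕ}

/-- In characteristic `p` the `p ^ n`-th power is additive, so pure tensors suffice. In `A`, an
element differs from the scalar `point k A a` by an element of `𝔪`, which the power kills. -/
theorem exists_pow_eq_algebraMap
    (hn : ∀ a ∈ IsLocalRing.maximalIdeal A, a ^ p ^ n = 0) (r : ℕ) (y : tensorPower k A r) :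
    ∃ c : k, y ^ p ^ n = algebraMap k (tensorPower k A r) c := by
  induction r with
  | zero => exact ⟨y ^ p ^ n, rfl⟩
  | succ r ih =>
    change A ⊗[k] tensorPower k A r at y
    change ∃ c : k, y ^ p ^ n = algebraMap k (A ⊗[k] tensorPower k A r) c
    have hA : CharP A p := charP_of_injective_algebraMap (algebraMap k A).injective p
    have : CharP (A ⊗[k] tensorPower k A r) p := by
      have : Nontrivial (tensorPower k A r) := (augmentation k A r).toRingHom.domain_nontrivial
      exact charP_of_injective_algebraMap (algebraMap k (A ⊗[k] tensorPower k A r)).injective p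
    induction y with
    | zero => exact ⟨0, by rw [map_zero, zero_pow (pow_ne_zero _ (Fact.out : p.Prime).ne_zero)]⟩
    | add y z hy hz =>
      obtain ⟨c, hc⟩ := hy
      obtain ⟨d, hd⟩ := hz
      exact ⟨c + d, by rw [add_pow_char_pow, hc, hd, map_add]⟩
    | tmul a z =>
      obtain ⟨c, hc⟩ := ih z
      have ha : a ^ p ^ n = algebraMap k A (point k A a ^ p ^ n) := by
        have := hn _ (sub_point_mem (k := k) a)
        rwa [sub_pow_char_pow, sub_eq_zero, ← map_pow] at this
      refine ⟨point k A a ^ p ^ n * c, ?_⟩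
      rw [Algebra.TensorProduct.tmul_pow, ha, hc, map_mul,
        Algebra.TensorProduct.algebraMap_apply, Algebra.TensorProduct.algebraMap_apply',
        Algebra.TensorProduct.tmul_mul_tmul, one_mul, mul_one]

/-- The power is a scalar; the augmentation, under which every word becomes trivial, tells which
one. -/
theorem coeff_word_pow (hn : ∀ a ∈ IsLocalRing.maximalIdeal A, a ^ p ^ n = 0) (r : ℕ) (X : Obj k A)
    (v : X.V) (ξ : Module.Dual k X.V) :
    (word k A r).coeff X v ξ ^ p ^ n = algebraMap k (tensorPower k A r) (ξ v ^ p ^ n) := by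
  obtain ⟨c, hc⟩ := exists_pow_eq_algebraMap p hn r ((word k A r).coeff X v ξ)
  have h := congrArg (augmentation k A r) hc
  rw [map_pow, augmentation_coeff_word, AlgHom.commutes] at h
  rw [hc, h]
  rfl

end Frobenius

/-- The coordinate ring of `Σ_D`: the families of matrix coefficients of the words `word k A r`. -/
noncomputable def coordRing : Subalgebra k (∀ r, tensorPower k A r) where
  carrier := {f | ∃ (X : Obj k A) (v : X.V) (ξ : Module.Dual k X.V),
    f = fun r => (word k A r).coeff X v ξ}
  mul_mem' := by
    rintro _ _ ⟨X, v, ξ, rfl⟩ ⟨Y, w, η, rfl⟩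
    exact ⟨X.tensor Y, v ⊗ₜ w, TensorProduct.dualDistrib k X.V Y.V (ξ ⊗ₜ η),
      funext fun r => ((word k A r).coeff_tensor X Y v w ξ η).symm⟩
  add_mem' := by
    rintro _ _ ⟨X, v, ξ, rfl⟩ ⟨Y, w, η, rfl⟩
    exact ⟨X.prod Y, (v, w), LinearMap.coprod ξ η,
      funext fun r => ((word k A r).coeff_prod X Y v w ξ η).symm⟩
  algebraMap_mem' c := ⟨Obj.unit k A, c, LinearMap.id,
    funext fun r => ((word k A r).coeff_unit c LinearMap.id).symm⟩

variable {k A}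

/-- The matrix coefficients of an object, as elements of the coordinate ring. -/
noncomputable def matrixCoeff (X : Obj k A) : X.V →ₗ[k] Module.Dual k X.V →ₗ[k] coordRing k A :=
  LinearMap.mk₂ k (fun v ξ => ⟨fun r => (word k A r).coeff X v ξ, X, v, ξ, rfl⟩)
    (fun v w ξ => Subtype.ext (funext fun r => by simp))
    (fun c v ξ => Subtype.ext (funext fun r => by simp))
    (fun v ξ η => Subtype.ext (funext fun r => by simp))
    (fun c v ξ => Subtype.ext (funext fun r => by simp))

theorem exists_matrixCoeff (f : coordRing k A) :
    ∃ (X : Obj k A) (v : X.V) (ξ : Module.Dual k X.V), matrixCoeff X v ξ = f := by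
  obtain ⟨f, X, v, ξ, rfl⟩ := f
  exact ⟨X, v, ξ, rfl⟩

theorem matrixCoeff_naturality {X Y : Obj k A} (f : X ⟶ Y) (v : X.V) (ξ : Module.Dual k Y.V) :
    matrixCoeff Y (f.map v) ξ = matrixCoeff X v (ξ ∘ₗ f.map) :=
  Subtype.ext (funext fun r => (word k A r).coeff_naturality f v ξ)

theorem matrixCoeff_unit (c : k) (ξ : Module.Dual k k) :
    matrixCoeff (Obj.unit k A) c ξ = algebraMap k (coordRing k A) (ξ c) :=
  Subtype.ext (funext fun r => (word k A r).coeff_unit c ξ)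

theorem matrixCoeff_tensor (X Y : Obj k A) (v : X.V) (w : Y.V) (ξ : Module.Dual k X.V)
    (η : Module.Dual k Y.V) :
    matrixCoeff (X.tensor Y) (v ⊗ₜ w) (TensorProduct.dualDistrib k X.V Y.V (ξ ⊗ₜ η)) =
      matrixCoeff X v ξ * matrixCoeff Y w η :=
  Subtype.ext (funext fun r => (word k A r).coeff_tensor X Y v w ξ η)

theorem matrixCoeff_prod (X Y : Obj k A) (v : X.V) (w : Y.V) (ξ : Module.Dual k X.V)
    (η : Module.Dual k Y.V) :
    matrixCoeff (X.prod Y) (v, w) (LinearMap.coprod ξ η) =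
      matrixCoeff X v ξ + matrixCoeff Y w η :=
  Subtype.ext (funext fun r => (word k A r).coeff_prod X Y v w ξ η)

/-- The exponent does not depend on `r`, so the identity holds in the infinite product. -/
theorem matrixCoeff_pow (p : ℕ) [Fact p.Prime] [CharP k p] {n : ℕ}
    (hn : ∀ a ∈ IsLocalRing.maximalIdeal A, a ^ p ^ n = 0) (X : Obj k A)
    (v : X.V) (ξ : Module.Dual k X.V) :
    matrixCoeff X v ξ ^ p ^ n = algebraMap k (coordRing k A) (ξ v ^ p ^ n) :=
  Subtype.ext (funext fun r => coeff_word_pow p hn r X v ξ)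

/-- The counit of the coordinate ring. -/
noncomputable def counit : coordRing k A →ₐ[k] k :=
  (Pi.evalAlgHom k (fun r => tensorPower k A r) 0).comp (coordRing k A).val

/-- The counit reads off the empty word, which is the identity. -/
theorem counit_matrixCoeff (X : Obj k A) (v : X.V) (ξ : Module.Dual k X.V) :
    counit (matrixCoeff X v ξ) = ξ v :=
  TensorAut.coeff_one (R := k) X v ξ

theorem exists_pow_maximalIdeal_eq_zero (B : Type u) [CommRing B] [IsLocalRing B]
    [IsArtinianRing B] (p : ℕ) [Fact p.Prime] :
    ∃ n, ∀ a ∈ IsLocalRing.maximalIdeal B, a ^ p ^ n = 0 := by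
  obtain ⟨n, hn⟩ := (isArtinianRing_iff_isNilpotent_maximalIdeal B).1 inferInstance
  refine ⟨n, fun a ha => ?_⟩
  have h : a ^ n = 0 := by
    have := Ideal.pow_mem_pow ha n
    rwa [hn] at this
  exact pow_eq_zero_of_le (Nat.lt_pow_self (Fact.out : p.Prime).one_lt).le h

theorem isNilpotent_of_counit_eq_zero (p : ℕ) [Fact p.Prime] [CharP k p] {f : coordRing k A}
    (hf : counit f = 0) : IsNilpotent f := by
  have : IsArtinianRing A := IsArtinianRing.of_finite k A
  obtain ⟨n, hn⟩ := exists_pow_maximalIdeal_eq_zero A p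
  obtain ⟨X, v, ξ, rfl⟩ := exists_matrixCoeff f
  refine ⟨p ^ n, ?_⟩
  rw [counit_matrixCoeff] at hf
  rw [matrixCoeff_pow p hn, hf, zero_pow (pow_ne_zero _ (Fact.out : p.Prime).ne_zero), map_zero]

/-- Such an `f` is a nonzero scalar plus a nilpotent. -/
theorem isUnit_of_counit_ne_zero (p : ℕ) [Fact p.Prime] [CharP k p] {f : coordRing k A}
    (hf : counit f ≠ 0) : IsUnit f := by
  have h : IsNilpotent (f - algebraMap k (coordRing k A) (counit f)) :=
    isNilpotent_of_counit_eq_zero p (by rw [map_sub, AlgHom.commutes]; exact sub_self _)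
  have hu := (IsUnit.mk0 _ hf).map (algebraMap k (coordRing k A))
  simpa using h.isUnit_add_left_of_commute hu (Commute.all _ _)

/-- `Spec` of the coordinate ring has exactly one closed point. -/
theorem existsUnique_isClosed_singleton (p : ℕ) [Fact p.Prime] [CharP k p] :
    ∃! x : PrimeSpectrum (coordRing k A), IsClosed ({x} : Set (PrimeSpectrum (coordRing k A))) := by
  have hs : Function.Surjective (counit (k := k) (A := A)) := fun c =>
    ⟨algebraMap k _ c, counit.commutes c⟩
  have hmax : (RingHom.ker (counit (k := k) (A := A))).IsMaximal :=
    RingHom.ker_isMaximal_of_surjective _ hs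
  refine ⟨⟨_, hmax.isPrime⟩, (PrimeSpectrum.isClosed_singleton_iff_isMaximal _).2 hmax,
    fun y hy => ?_⟩
  have hy' := (PrimeSpectrum.isClosed_singleton_iff_isMaximal _).1 hy
  -- The kernel of the counit consists of nilpotents, so it lies in every prime.
  refine PrimeSpectrum.ext (hmax.eq_of_le hy'.ne_top fun f hf => ?_).symm
  obtain ⟨n, hn⟩ := isNilpotent_of_counit_eq_zero p hf
  exact y.isPrime.mem_of_pow_mem n (hn ▸ y.asIdeal.zero_mem)

/-- The counit sends this matrix to the identity, so its determinant has counit `1`. No antipode has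
to be constructed. -/
theorem isUnit_det_matrixCoeff (p : ℕ) [Fact p.Prime] [CharP k p] (X : Obj k A) :
    IsUnit (Matrix.of fun i j => matrixCoeff X (Module.finBasis k X.V j)
      ((Module.finBasis k X.V).coord i)).det := by
  apply isUnit_of_counit_ne_zero p
  rw [AlgHom.map_det]
  convert one_ne_zero (α := k)
  rw [← Matrix.det_one (n := Fin (Module.finrank k X.V))]
  congr 1
  ext i j
  rw [AlgHom.mapMatrix_apply, Matrix.map_apply, Matrix.of_apply, counit_matrixCoeff]
  simp [Finsupp.single_apply, Matrix.one_apply, eq_comm]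

variable (k A) in
/-- The universal tensor automorphism, over the coordinate ring. -/
noncomputable def universal (p : ℕ) [Fact p.Prime] [CharP k p] :
    TensorAut k A (coordRing k A) :=
  TensorAut.ofCoeff matrixCoeff matrixCoeff_naturality matrixCoeff_unit matrixCoeff_tensor
    (isUnit_det_matrixCoeff p)

theorem coeff_universal (p : ℕ) [Fact p.Prime] [CharP k p] (X : Obj k A) (v : X.V)
    (ξ : Module.Dual k X.V) : (universal k A p).coeff X v ξ = matrixCoeff X v ξ :=
  TensorAut.coeff_ofCoeff _ _ _ _ _ X v ξ

/-! ### Representability of `Σ_D` -/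

section Representability

variable {R : Type u} [CommRing R] [Algebra k R]

/-- The longer word's coefficient expands along a basis of the new factor `A`, with the coefficients
at the components as coordinates; all of these vanish. -/
theorem coeff_component_eq_zero {X : Obj k A} {v : X.V} {ξ : Module.Dual k X.V} {r : ℕ}
    (h : (word k A (r + 1)).coeff X v ξ = 0) (l : Module.Dual k A) :
    (word k A r).coeff X (X.component l v) ξ = 0 := by
  let b := Module.finBasis k A
  have hb : ∀ i, (word k A r).coeff X (X.component (b.coord i) v) ξ = 0 := by
    have h' : (word k A r).mulTautological.coeff X v ξ = 0 := h
    rw [TensorAut.coeff_mulTautological _ b] at h'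
    classical
    intro i
    have := congrArg (TensorProduct.lid k _ ∘ (b.coord i).rTensor (tensorPower k A r)) h'
    simpa [Finsupp.single_apply, ite_smul] using this
  have hl : X.component l v = ∑ i, l (b i) • X.component (b.coord i) v := by
    conv_lhs => rw [Obj.component, ← b.sum_dual_apply_smul_coord l, ← LinearMap.coe_rTensorHom,
      map_sum]
    simp [Obj.component]
  rw [hl]
  simp [hb]

/-- If a matrix coefficient vanishes on all words, it vanishes on all tensor automorphisms. -/
theorem coeff_eq_zero_of_matrixCoeff (x : TensorAut k A R) {X : Obj k A} {v : X.V}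
    {ξ : Module.Dual k X.V} (h : matrixCoeff X v ξ = 0) : x.coeff X v ξ = 0 := by
  let W : Submodule k X.V := LinearMap.ker ((matrixCoeff X).flip ξ)
  -- Vanishing on words of length `r + 1` gives vanishing of the components on words of length `r`.
  have hW : ∀ l : Module.Dual k A, ∀ w ∈ W, X.component l w ∈ W := fun l w hw =>
    Subtype.ext (funext fun r =>
      coeff_component_eq_zero (congrFun (congrArg Subtype.val hw) (r + 1)) l)
  have hξ : ξ ∘ₗ W.subtype = 0 := LinearMap.ext fun w => by
    have := counit_matrixCoeff X w ξ
    rw [show matrixCoeff X w ξ = 0 from w.2, map_zero] at this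
    exact this.symm
  -- The coefficient can be computed on the subobject `W`, where the restricted form is zero.
  have := x.coeff_naturality (X.subι W hW) ⟨v, h⟩ ξ
  exact this.trans (by
    rw [show ξ ∘ₗ (X.subι W hW).map = 0 from hξ, map_zero])

/-- The difference of the two coefficients is a single coefficient of `X.prod Y`, to which the
vanishing criterion applies. -/
theorem coeff_eq_of_matrixCoeff_eq (x : TensorAut k A R) {X Y : Obj k A} {v : X.V} {w : Y.V}
    {ξ : Module.Dual k X.V} {η : Module.Dual k Y.V} (h : matrixCoeff X v ξ = matrixCoeff Y w η) :
    x.coeff X v ξ = x.coeff Y w η := by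
  have := coeff_eq_zero_of_matrixCoeff x
    (X := X.prod Y) (v := (v, w)) (ξ := LinearMap.coprod ξ (-η))
    (by rw [matrixCoeff_prod, map_neg, h, add_neg_cancel])
  rwa [x.coeff_prod, map_neg, add_neg_eq_zero] at this

/-- The value of an element of the coordinate ring at a tensor automorphism. -/
noncomputable def evalAt (x : TensorAut k A R) (f : coordRing k A) : R :=
  x.coeff _ (exists_matrixCoeff f).choose_spec.choose
    (exists_matrixCoeff f).choose_spec.choose_spec.choose

/-- The value does not depend on the chosen presentation of the element as a coefficient. -/
theorem evalAt_matrixCoeff (x : TensorAut k A R) (X : Obj k A) (v : X.V)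
    (ξ : Module.Dual k X.V) : evalAt x (matrixCoeff X v ξ) = x.coeff X v ξ :=
  coeff_eq_of_matrixCoeff_eq x
    (exists_matrixCoeff (matrixCoeff X v ξ)).choose_spec.choose_spec.choose_spec

theorem evalAt_algebraMap (x : TensorAut k A R) (c : k) :
    evalAt x (algebraMap k (coordRing k A) c) = algebraMap k R c := by
  have h := matrixCoeff_unit (A := A) c LinearMap.id
  rw [LinearMap.id_apply] at h
  rw [← h, evalAt_matrixCoeff, x.coeff_unit, LinearMap.id_apply]

/-- Evaluation at a tensor automorphism, as a homomorphism of algebras. -/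
noncomputable def evalHom (x : TensorAut k A R) : coordRing k A →ₐ[k] R where
  toFun := evalAt x
  map_one' := by rw [← map_one (algebraMap k _), evalAt_algebraMap, map_one]
  map_zero' := by rw [← map_zero (algebraMap k _), evalAt_algebraMap, map_zero]
  map_mul' f g := by
    obtain ⟨X, v, ξ, rfl⟩ := exists_matrixCoeff f
    obtain ⟨Y, w, η, rfl⟩ := exists_matrixCoeff g
    exact (congrArg (evalAt x) (matrixCoeff_tensor X Y v w ξ η).symm).trans
      ((evalAt_matrixCoeff x _ _ _).trans ((x.coeff_tensor X Y v w ξ η).trans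
        (by rw [evalAt_matrixCoeff, evalAt_matrixCoeff])))
  map_add' f g := by
    obtain ⟨X, v, ξ, rfl⟩ := exists_matrixCoeff f
    obtain ⟨Y, w, η, rfl⟩ := exists_matrixCoeff g
    exact (congrArg (evalAt x) (matrixCoeff_prod X Y v w ξ η).symm).trans
      ((evalAt_matrixCoeff x _ _ _).trans ((x.coeff_prod X Y v w ξ η).trans
        (by rw [evalAt_matrixCoeff, evalAt_matrixCoeff])))
  commutes' := evalAt_algebraMap x

variable (p : ℕ) [Fact p.Prime] [CharP k p]

theorem extend_evalHom_universal (x : TensorAut k A R) :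
    TensorAut.extend (evalHom x) (universal k A p) = x :=
  TensorAut.ext_coeff fun X v ξ => by
    rw [TensorAut.coeff_extend, coeff_universal]
    exact evalAt_matrixCoeff x X v ξ

theorem evalHom_extend_universal (φ : coordRing k A →ₐ[k] R) :
    evalHom (TensorAut.extend φ (universal k A p)) = φ :=
  AlgHom.ext fun f => by
    obtain ⟨X, v, ξ, rfl⟩ := exists_matrixCoeff f
    refine (evalAt_matrixCoeff _ X v ξ).trans ?_
    rw [TensorAut.coeff_extend, coeff_universal]

variable (k A) in
/-- `Σ_D` is represented by the coordinate ring. -/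
noncomputable def tannakaGroupCorepresentableBy :
    (tannakaGroup k A ⋙ forget GrpCat).CorepresentableBy (CommAlgCat.of k (coordRing k A)) where
  homEquiv {R} :=
    { toFun := fun φ => TensorAut.extend φ.hom (universal k A p)
      invFun := fun x => CommAlgCat.ofHom (evalHom (R := R) x)
      left_inv := fun φ => CommAlgCat.hom_ext (evalHom_extend_universal p φ.hom)
      right_inv := fun x => extend_evalHom_universal p x }
  homEquiv_comp ψ φ := by
    change TensorAut.extend (ψ.hom.comp φ.hom) (universal k A p) = _
    rw [TensorAut.extend_comp]
    rfl

variable (k A) in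
theorem isLocalGroupScheme_tannakaGroup (p : ℕ) [Fact p.Prime] [CharP k p] :
    IsLocalGroupScheme (tannakaGroup k A) :=
  ⟨CommAlgCat.of k (coordRing k A), ⟨tannakaGroupCorepresentableBy k A p⟩,
    existsUnique_isClosed_singleton p⟩

end Representability

end CoordinateRing

end SigmaD

namespace SigmaD

/-! ### Frobenius kernels and the height -/

section Height

theorem frobPower_eq_bot_iff {B : Type u} [CommRing B] (I : Ideal B) (q : ℕ) :
    frobPower I q = ⊥ ↔ ∀ a ∈ I, a ^ q = 0 := by
  simp [frobPower]

/-- The nilpotent endomorphism `(s, t) ↦ (t, 0)` of `k²`. -/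
def shift (k : Type u) [CommRing k] : k × k →ₗ[k] k × k :=
  LinearMap.inl k k k ∘ₗ LinearMap.snd k k k

/-- From `N² = 0` it follows that `1 - aN` is inverse to `1 + aN`. -/
theorem baseChange_shift_shift {k : Type u} [CommRing k] {R : Type u} [CommRing R] [Algebra k R]
    (x : R ⊗[k] (k × k)) :
    (shift k).baseChange R ((shift k).baseChange R x) = 0 := by
  rw [← LinearMap.comp_apply, ← LinearMap.baseChange_comp,
    show shift k ∘ₗ shift k = 0 from by ext <;> simp [shift],
    LinearMap.baseChange_zero, LinearMap.zero_apply]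

variable {k : Type u} [Field k] [IsAlgClosed k]
  {A : Type u} [CommRing A] [Algebra k A] [Module.Finite k A] [IsLocalRing A]

theorem coeff_map_frobHom (p : ℕ) [Fact p.Prime] [CharP k p] (n : ℕ) (R : CommAlgCat.{u} k)
    (x : TensorAut k A R) (X : Obj k A) (v : X.V) (ξ : Module.Dual k X.V) :
    (TensorAut.extend (frobHom p n R).hom x).coeff X v ξ = (x.coeff X v ξ ^ p ^ n : R) :=
  TensorAut.coeff_extend _ x X v ξ

theorem killedByFrob_of_pow_eq_zero (p : ℕ) [Fact p.Prime] [CharP k p] {n : ℕ}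
    (hn : ∀ a ∈ IsLocalRing.maximalIdeal A, a ^ p ^ n = 0) :
    KilledByFrob p (tannakaGroup k A) n := fun R x => by
  change TensorAut k A R at x
  change TensorAut.extend (frobHom p n R).hom x = 1
  refine TensorAut.ext_coeff fun X v ξ => ?_
  rw [coeff_map_frobHom, TensorAut.coeff_one]
  -- In the twisted algebra a scalar `c` acts as `c ^ p ^ n`, which supplies the power on the right.
  change x.coeff X v ξ ^ p ^ n = algebraMap k R (iterateFrobenius k p n (ξ v))
  rw [← evalAt_matrixCoeff x]
  change evalHom x _ ^ p ^ n = _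
  rw [← map_pow, matrixCoeff_pow p hn, AlgHom.commutes, iterateFrobenius_def]

/-- The object `(k², 1 + a N)` of `𝒮_D`, where `N (s, t) = (t, 0)` and `a` is in the maximal
ideal. -/
noncomputable abbrev unipotent (a : A) (ha : a ∈ IsLocalRing.maximalIdeal A) : Obj k A where
  V := k × k
  β := LinearEquiv.ofLinearMap
      (LinearMap.id + a • (shift k).baseChange A) (LinearMap.id - a • (shift k).baseChange A)
      (LinearMap.ext fun x => by simp [baseChange_shift_shift])
      (LinearMap.ext fun x => by simp [baseChange_shift_shift])
  pull_point := pull_ext fun v => by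
    rw [pull_tmul, one_smul]
    change (point k A).toLinearMap.rTensor (k × k)
      (1 ⊗ₜ v + a • (shift k).baseChange A (1 ⊗ₜ v)) = 1 ⊗ₜ v
    rw [map_add, rTensor_smul, point_eq_zero ha]
    simp

theorem coeff_tautological_unipotent (a : A) (ha : a ∈ IsLocalRing.maximalIdeal A) :
    (tautological : TensorAut k A A).coeff (unipotent a ha) ((0, 1) : k × k)
      (LinearMap.fst k k k) = a := by
  change evalDual A (LinearMap.fst k k k) ((1 ⊗ₜ[k] ((0, 1) : k × k) : A ⊗[k] (k × k)) +
    a • (shift k).baseChange A (1 ⊗ₜ ((0, 1) : k × k))) = a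
  simp [shift]

/-- The tautological `A`-point has `a` as an off-diagonal entry on `unipotent a ha`. Frobenius
raises it to `a ^ p ^ n`, while the identity has entry `0` there. -/
theorem pow_eq_zero_of_killedByFrob (p : ℕ) [Fact p.Prime] [CharP k p] {n : ℕ}
    (h : KilledByFrob p (tannakaGroup k A) n) (a : A) (ha : a ∈ IsLocalRing.maximalIdeal A) :
    a ^ p ^ n = 0 := by
  have h1 : TensorAut.extend (frobHom p n (CommAlgCat.of k A)).hom (tautological : TensorAut k A A)
    = 1 := h (CommAlgCat.of k A) tautological
  have h2 := coeff_map_frobHom p n (CommAlgCat.of k A) (tautological : TensorAut k A A)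
    (unipotent a ha) ((0, 1) : k × k) (LinearMap.fst k k k)
  rw [h1, TensorAut.coeff_one] at h2
  have h3 : (algebraMap k A (iterateFrobenius k p n 0)) = a ^ p ^ n :=
    h2.trans (congrArg (· ^ p ^ n) (coeff_tautological_unipotent a ha))
  rw [← h3, map_zero, map_zero]

variable (k A) in
/-- `Fr^n` annihilates `Σ_D` if and only if `𝔪^{[p^n]} = 0`. -/
theorem killedByFrob_tannakaGroup_iff (p : ℕ) [Fact p.Prime] [CharP k p] (n : ℕ) :
    KilledByFrob p (tannakaGroup k A) n ↔
      frobPower (IsLocalRing.maximalIdeal A) (p ^ n) = ⊥ := by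
  rw [frobPower_eq_bot_iff]
  exact ⟨pow_eq_zero_of_killedByFrob p, killedByFrob_of_pow_eq_zero p⟩

end Height

end SigmaD

theorem proposition25p02 (p : ℕ) [Fact p.Prime] (k : Type u) [Field k] [IsAlgClosed k] [CharP k p]
    (A : Type u) [CommRing A] [Algebra k A] [Module.Finite k A] [IsLocalRing A] :
    SigmaD.IsLocalGroupScheme (SigmaD.tannakaGroup k A) ∧
    ∀ h : ℕ, 1 ≤ h →
      SigmaD.frobPower (IsLocalRing.maximalIdeal A) (p ^ h) = ⊥ →
      SigmaD.frobPower (IsLocalRing.maximalIdeal A) (p ^ (h - 1)) ≠ ⊥ →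
        SigmaD.KilledByFrob p (SigmaD.tannakaGroup k A) h ∧
        ¬ SigmaD.KilledByFrob p (SigmaD.tannakaGroup k A) (h - 1) ∧
        SigmaD.HasHeight p (SigmaD.tannakaGroup k A) h := by
  refine ⟨SigmaD.isLocalGroupScheme_tannakaGroup k A p, fun h _ h₁ h₂ => ?_⟩
  have hk := (SigmaD.killedByFrob_tannakaGroup_iff k A p h).2 h₁
  refine ⟨hk, fun hk' => h₂ ((SigmaD.killedByFrob_tannakaGroup_iff k A p (h - 1)).1 hk'), hk,
    fun n hn => ?_⟩
  by_contra hlt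
  have hn' := (SigmaD.frobPower_eq_bot_iff _ _).1
    ((SigmaD.killedByFrob_tannakaGroup_iff k A p n).1 hn)
  refine h₂ ((SigmaD.frobPower_eq_bot_iff _ _).2 fun a ha => ?_)
  -- Since `n < h` means `n ≤ h - 1`, vanishing of `p ^ n`-th powers on `𝔪` passes to `p ^ (h -
  -- 1)`-th powers.
  exact pow_eq_zero_of_le (Nat.pow_le_pow_right (Fact.out : p.Prime).pos (by omega)) (hn' a ha)
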